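/- Let $H^2$ be the Hardy space of the open unit disk $\mathbb{D}$: the analytic functions $f(z)=\sum_{n\ge 0}a_nz^n$ on $\mathbb{D}$ whose integral means $\int_{\mathbb{T}}|f(r\zeta)|^2\,dm(\zeta)$ ($m$ the normalized arc length on the unit circle $\mathbb{T}$) stay bounded for $0<r<1$, a Hilbert space with $\langle f,g\rangle=\sum_{n\ge0}a_n\overline{b_n}$ for $g(z)=\sum_{n\ge 0}b_nz^n$. Let $(\lambda_n)$ be a finite or infinite sequence of distinct points of $\mathbb{D}$ with $\sum_n(1-|\lambda_n|)<\infty$, and let $u$ be a Blaschke product with simple zeros $\lambda_1,\lambda_2,\ldots$, i.e. $$u(z)=c\prod_n b_{\lambda_n}(z),\qquad |c|=1,\qquad b_\lambda(z)=\frac{|\lambda|}{\lambda}\,\frac{\lambda-z}{1-\overline{\lambda}z}\ (\lambda\ne0),\qquad b_0(z)=z .$$ Let $\mathcal{K}_u=(uH^2)^{\perp}$ be the orthogonal complement of $uH^2$ in $H^2$, and let $k_\lambda(z)=\dfrac{1-\overline{u(\lambda)}u(z)}{1-\overline{\lambda}z}$ be its reproducing kernel at $\lambda\in\mathbb{D}$.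 Then: 1. for every $n$, $k_{\lambda_n}(z)=\dfrac{1}{1-\overline{\lambda_n}z}$ for all $z\in\mathbb{D}$, that is, $k_{\lambda_n}$ is the Cauchy kernel at $\lambda_n$; 2. the closed linear span in $H^2$ of $\{k_{\lambda_1},k_{\lambda_2},\ldots\}$ equals $\mathcal{K}_u$; 3. $\mathcal{K}_u$ contains a dense subset each of whose elements extends continuously to the closed disk $\mathbb{D}^-$ and has an infinitely differentiable boundary function on $\mathbb{T}$. -/

import Mathlib

open scoped ComplexConjugate ContDiff Manifold InnerProductSpace Topology

namespace ModelSpace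

open Complex

noncomputable section

/-- The extension by zero to `ℂ` of a function on the open unit disk. -/
def discExtend (f : UnitDisc → ℂ) (z : ℂ) : ℂ :=
  if hz : ‖z‖ < 1 then f (UnitDisc.mk z hz) else 0

/-- `f` is analytic on the open unit disk. -/
def IsDiscAnalytic (f : UnitDisc → ℂ) : Prop :=
  DifferentiableOn ℂ (discExtend f) (Metric.ball 0 1)

/-- The integral mean `∫_𝕋 |f (r ζ)|² dm(ζ)`, with `m` the normalized arc length on the circle. -/
def integralMean (f : UnitDisc → ℂ) (r : ℝ) : ℝ :=
  Real.circleAverage (fun z => ‖discExtend f z‖ ^ 2) 0 r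

/-- The `n`-th Taylor coefficient of `f` at the origin. -/
def taylorCoeff (f : UnitDisc → ℂ) (n : ℕ) : ℂ :=
  (n.factorial : ℂ)⁻¹ * iteratedDeriv n (discExtend f) 0

theorem discExtend_coe (f : UnitDisc → ℂ) (z : UnitDisc) : discExtend f z = f z := by
  simp [discExtend, z.norm_lt_one]

theorem discExtend_of_lt (f : UnitDisc → ℂ) {z : ℂ} (hz : ‖z‖ < 1) :
    discExtend f z = f (UnitDisc.mk z hz) := by
  simp [discExtend, hz]

theorem discExtend_add (f g : UnitDisc → ℂ) :
    discExtend (f + g) = discExtend f + discExtend g := by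
  ext z; by_cases hz : ‖z‖ < 1 <;> simp [discExtend, hz]

theorem discExtend_smul (c : ℂ) (f : UnitDisc → ℂ) :
    discExtend (c • f) = c • discExtend f := by
  ext z; by_cases hz : ‖z‖ < 1 <;> simp [discExtend, hz]

theorem discExtend_zero : discExtend 0 = 0 := by
  ext z; simp [discExtend]

theorem IsDiscAnalytic.continuous_circleMap {f : UnitDisc → ℂ} (hf : IsDiscAnalytic f) {r : ℝ}
    (hr : r ∈ Set.Ioo (0 : ℝ) 1) : Continuous fun θ : ℝ => discExtend f (circleMap 0 r θ) := by
  refine ContinuousOn.comp_continuous (DifferentiableOn.continuousOn hf)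
    (_root_.continuous_circleMap 0 r) fun θ => ?_
  simp [abs_of_pos hr.1, hr.2]

theorem IsDiscAnalytic.circleIntegrable_sq {f : UnitDisc → ℂ} (hf : IsDiscAnalytic f) {r : ℝ}
    (hr : r ∈ Set.Ioo (0 : ℝ) 1) :
    CircleIntegrable (fun z => ‖discExtend f z‖ ^ 2) 0 r :=
  ((hf.continuous_circleMap hr).norm.pow 2).intervalIntegrable _ _

theorem IsDiscAnalytic.add {f g : UnitDisc → ℂ} (hf : IsDiscAnalytic f) (hg : IsDiscAnalytic g) :
    IsDiscAnalytic (f + g) := by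
  unfold IsDiscAnalytic
  rw [discExtend_add]
  exact DifferentiableOn.add hf hg

theorem IsDiscAnalytic.smul {f : UnitDisc → ℂ} (c : ℂ) (hf : IsDiscAnalytic f) :
    IsDiscAnalytic (c • f) := by
  unfold IsDiscAnalytic
  rw [discExtend_smul]
  exact DifferentiableOn.const_smul hf c

/-- The Hardy space `H²` as a linear space of functions on the disk: the analytic functions with
bounded integral means. -/
def hardySubmodule : Submodule ℂ (UnitDisc → ℂ) where
  carrier := {f | IsDiscAnalytic f ∧ ∃ C : ℝ, ∀ r ∈ Set.Ioo (0 : ℝ) 1, integralMean f r ≤ C}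
  zero_mem' := by
    refine ⟨?_, 0, fun r _ => ?_⟩
    · simp only [IsDiscAnalytic, discExtend_zero]
      exact differentiableOn_const 0
    · simp [integralMean, discExtend_zero, Real.circleAverage]
  add_mem' := by
    rintro f g ⟨hf, C, hC⟩ ⟨hg, D, hD⟩
    refine ⟨hf.add hg, 2 * C + 2 * D, fun r hr => ?_⟩
    have hfi := hf.circleIntegrable_sq hr
    have hgi := hg.circleIntegrable_sq hr
    calc integralMean (f + g) r
        ≤ Real.circleAverage
          ((2 : ℝ) • (fun z => ‖discExtend f z‖ ^ 2) + (2 : ℝ) • fun z => ‖discExtend g z‖ ^ 2)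
          0 r := by
          refine Real.circleAverage_mono ((hf.add hg).circleIntegrable_sq hr)
            ((hfi.const_smul (a := (2 : ℝ))).add (hgi.const_smul (a := (2 : ℝ)))) fun z _ => ?_
          simp only [discExtend_add, Pi.add_apply, Pi.smul_apply, smul_eq_mul]
          nlinarith [norm_add_le (discExtend f z) (discExtend g z), norm_nonneg
            (discExtend f z + discExtend g z), sq_nonneg (‖discExtend f z‖ - ‖discExtend g z‖)]
      _ = 2 * integralMean f r + 2 * integralMean g r := by
          rw [Real.circleAverage_add (hfi.const_smul (a := (2 : ℝ)))
            (hgi.const_smul (a := (2 : ℝ))), Real.circleAverage_smul, Real.circleAverage_smul]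
          rfl
      _ ≤ 2 * C + 2 * D := by linarith [hC r hr, hD r hr]
  smul_mem' := by
    rintro c f ⟨hf, C, hC⟩
    refine ⟨hf.smul c, ‖c‖ ^ 2 * C, fun r hr => ?_⟩
    have : integralMean (c • f) r = ‖c‖ ^ 2 * integralMean f r := by
      unfold integralMean
      rw [← smul_eq_mul, ← Real.circleAverage_smul]
      congr 1
      ext z
      simp [discExtend_smul, mul_pow]
    rw [this]
    exact mul_le_mul_of_nonneg_left (hC r hr) (by positivity)

theorem hasSum_taylorCoeff {f : UnitDisc → ℂ} (hf : IsDiscAnalytic f) {z : ℂ} (hz : ‖z‖ < 1) :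
    HasSum (fun n => taylorCoeff f n * z ^ n) (discExtend f z) := by
  have h := Complex.hasSum_taylorSeries_on_ball (c := 0) (r := 1) hf (by simpa using hz)
  refine h.congr_fun fun n => ?_
  simp [taylorCoeff]
  ring

/-- Parseval's identity on the circle of radius `r`. -/
theorem hasSum_integralMean {f : UnitDisc → ℂ} (hf : IsDiscAnalytic f) {r : ℝ}
    (hr : r ∈ Set.Ioo (0 : ℝ) 1) :
    HasSum (fun n => ‖taylorCoeff f n‖ ^ 2 * r ^ (2 * n)) (integralMean f r) := by
  let p : ℕ → Polynomial ℂ := fun N =>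
    ∑ n ∈ Finset.range N, Polynomial.monomial n (taylorCoeff f n * (r : ℂ) ^ n)
  have hcoeff : ∀ N n, (p N).coeff n =
      if n < N then taylorCoeff f n * (r : ℂ) ^ n else 0 := by
    intro N n
    simp [p, Polynomial.finsetSum_coeff, Polynomial.coeff_monomial]
  have hsum : ∀ N, ∑ n ∈ Finset.range N, ‖taylorCoeff f n‖ ^ 2 * r ^ (2 * n) =
      Real.circleAverage (fun z => ‖(p N).eval z‖ ^ 2) 0 1 := by
    intro N
    rw [← Polynomial.sum_sq_norm_coeff_eq_circleAverage]
    have hsub : (p N).support ⊆ Finset.range N := by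
      intro n hn
      rw [Polynomial.mem_support_iff, hcoeff] at hn
      simp only [Finset.mem_range]
      by_contra h
      simp [h] at hn
    rw [Finset.sum_subset hsub fun n _ hn => by
      rw [Polynomial.notMem_support_iff.1 hn]; simp]
    refine Finset.sum_congr rfl fun n hn => ?_
    rw [hcoeff, if_pos (Finset.mem_range.1 hn), norm_mul, norm_pow, Complex.norm_real,
      Real.norm_of_nonneg hr.1.le, mul_pow, ← pow_mul, mul_comm n 2]
  have hr1 : ‖(r : ℂ)‖ < 1 := by
    rw [Complex.norm_real, Real.norm_of_nonneg hr.1.le]; exact hr.2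
  have habs : Summable fun n => ‖taylorCoeff f n * (r : ℂ) ^ n‖ :=
    (hasSum_taylorCoeff hf hr1).summable.norm
  have heval : ∀ N z, (p N).eval z =
      ∑ n ∈ Finset.range N, taylorCoeff f n * ((r : ℂ) * z) ^ n := by
    intro N z
    simp [p, Polynomial.eval_finsetSum, mul_pow, mul_assoc]
  have hlim : Filter.Tendsto
      (fun N => Real.circleAverage (fun z => ‖(p N).eval z‖ ^ 2) 0 1) Filter.atTop
      (𝓝 (integralMean f r)) := by
    rw [integralMean, Real.circleAverage_eq_circleAverage_zero_one]
    unfold Real.circleAverage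
    refine Filter.Tendsto.const_smul ?_ _
    refine intervalIntegral.tendsto_integral_filter_of_dominated_convergence
      (fun _ => (∑' n, ‖taylorCoeff f n * (r : ℂ) ^ n‖) ^ 2) ?_ ?_ ?_ ?_
    · refine Filter.Eventually.of_forall fun N => ?_
      refine Continuous.aestronglyMeasurable ?_
      exact (((p N).continuous.comp (_root_.continuous_circleMap 0 1)).norm).pow 2
    · refine Filter.Eventually.of_forall fun N => Filter.Eventually.of_forall fun θ _ => ?_
      rw [norm_pow, norm_norm]
      refine pow_le_pow_left₀ (norm_nonneg _) ?_ 2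
      rw [heval]
      refine (norm_sum_le _ _).trans ?_
      refine le_trans (le_of_eq ?_) (habs.sum_le_tsum (Finset.range N) fun _ _ => norm_nonneg _)
      refine Finset.sum_congr rfl fun n _ => ?_
      simp [mul_pow]
    · exact intervalIntegrable_const
    · refine Filter.Eventually.of_forall fun θ _ => ?_
      refine Filter.Tendsto.pow (Filter.Tendsto.norm ?_) 2
      simp only [heval, add_zero]
      refine (hasSum_taylorCoeff hf ?_).tendsto_sum_nat
      simpa using hr1
  have hsm : Summable fun n => ‖taylorCoeff f n‖ ^ 2 * r ^ (2 * n) := by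
    refine summable_of_sum_range_le (c := (∑' n, ‖taylorCoeff f n * (r : ℂ) ^ n‖) ^ 2)
      (fun n => mul_nonneg (by positivity) (pow_nonneg hr.1.le _)) fun N => ?_
    have hle : ∑ n ∈ Finset.range N, ‖taylorCoeff f n‖ ^ 2 * r ^ (2 * n) ≤
        (∑ n ∈ Finset.range N, ‖taylorCoeff f n * (r : ℂ) ^ n‖) ^ 2 := by
      refine le_trans (le_of_eq (Finset.sum_congr rfl fun n _ => ?_))
        (Finset.sum_sq_le_sq_sum_of_nonneg fun n _ => norm_nonneg _)
      rw [norm_mul, norm_pow, Complex.norm_real, Real.norm_of_nonneg hr.1.le, mul_pow, ← pow_mul,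
        mul_comm n 2]
    exact hle.trans (pow_le_pow_left₀ (Finset.sum_nonneg fun _ _ => norm_nonneg _)
      (habs.sum_le_tsum _ fun _ _ => norm_nonneg _) 2)
  refine (hsm.hasSum_iff_tendsto_nat).2 ?_
  simpa only [hsum] using hlim

theorem summable_sq_taylorCoeff {f : UnitDisc → ℂ} (hf : f ∈ hardySubmodule) :
    Summable fun n => ‖taylorCoeff f n‖ ^ 2 := by
  obtain ⟨hfa, C, hC⟩ := hf
  refine summable_of_sum_range_le (c := C) (fun n => by positivity) fun N => ?_
  have hcont : Filter.Tendsto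
      (fun r : ℝ => ∑ n ∈ Finset.range N, ‖taylorCoeff f n‖ ^ 2 * r ^ (2 * n)) (𝓝[<] 1)
      (𝓝 (∑ n ∈ Finset.range N, ‖taylorCoeff f n‖ ^ 2 * (1 : ℝ) ^ (2 * n))) := by
    refine Filter.Tendsto.mono_left (Continuous.tendsto (by fun_prop) 1) nhdsWithin_le_nhds
  simp only [one_pow, mul_one] at hcont
  refine le_of_tendsto hcont ?_
  filter_upwards [Ioo_mem_nhdsLT (zero_lt_one (α := ℝ))] with r hr
  refine le_trans ?_ (hC r hr)
  exact sum_le_hasSum _ (fun n _ => mul_nonneg (by positivity) (pow_nonneg hr.1.le _))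
    (hasSum_integralMean hfa hr)

theorem taylorCoeff_add {f g : UnitDisc → ℂ} (hf : IsDiscAnalytic f) (hg : IsDiscAnalytic g)
    (n : ℕ) : taylorCoeff (f + g) n = taylorCoeff f n + taylorCoeff g n := by
  have h0 : Metric.ball (0 : ℂ) 1 ∈ 𝓝 0 := Metric.ball_mem_nhds _ one_pos
  unfold taylorCoeff
  rw [discExtend_add, iteratedDeriv_add (DifferentiableOn.analyticAt hf h0).contDiffAt
    (DifferentiableOn.analyticAt hg h0).contDiffAt, mul_add]

theorem taylorCoeff_smul {f : UnitDisc → ℂ} (c : ℂ) (hf : IsDiscAnalytic f)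
    (n : ℕ) : taylorCoeff (c • f) n = c * taylorCoeff f n := by
  have h0 : Metric.ball (0 : ℂ) 1 ∈ 𝓝 0 := Metric.ball_mem_nhds _ one_pos
  unfold taylorCoeff
  rw [discExtend_smul, iteratedDeriv_const_smul (DifferentiableOn.analyticAt hf h0).contDiffAt,
    smul_eq_mul]
  ring

/-- The Hardy space `H²` of the unit disk. It is kept apart from `hardySubmodule` so that it carries
the norm topology and not the topology of pointwise convergence. -/
def HardySpace : Type := hardySubmodule

instance : AddCommGroup HardySpace := inferInstanceAs (AddCommGroup hardySubmodule)

instance : Module ℂ HardySpace := inferInstanceAs (Module ℂ hardySubmodule)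

/-- A member of `H²` as a function on the disk. -/
def HardySpace.toFun (f : HardySpace) : UnitDisc → ℂ := Subtype.val f

instance : CoeFun HardySpace fun _ => UnitDisc → ℂ := ⟨HardySpace.toFun⟩

theorem HardySpace.mem (f : HardySpace) : HardySpace.toFun f ∈ hardySubmodule := Subtype.property f

theorem HardySpace.toFun_add (f g : HardySpace) : (f + g).toFun = f.toFun + g.toFun := rfl

theorem HardySpace.toFun_smul (c : ℂ) (f : HardySpace) : (c • f).toFun = c • f.toFun := rfl

theorem HardySpace.toFun_zero : (0 : HardySpace).toFun = 0 := rfl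

theorem HardySpace.ext {f g : HardySpace} (h : ∀ z, f z = g z) : f = g :=
  Subtype.ext (funext h)

/-- The sequence of Taylor coefficients of a member of `H²`, in `ℓ²`. -/
def HardySpace.coeffs (f : HardySpace) : lp (fun _ : ℕ => ℂ) 2 :=
  ⟨taylorCoeff f, memℓp_gen (by simpa using summable_sq_taylorCoeff f.mem)⟩

/-- The inner product of `H²`, `⟨f, g⟩ = ∑ aₙ conj bₙ` in terms of the Taylor coefficients of `f` and
`g`. Following Mathlib, `⟪g, f⟫` is linear in its second argument `f`. -/
@[reducible] def HardySpace.innerCore : InnerProductSpace.Core ℂ HardySpace where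
  inner g f := ∑' n, taylorCoeff f n * conj (taylorCoeff g n)
  conj_inner_symm f g := inner_conj_symm f.coeffs g.coeffs
  re_inner_nonneg f := inner_self_nonneg (𝕜 := ℂ) (x := f.coeffs)
  add_left f g h := by
    have hadd : (f + g).coeffs = f.coeffs + g.coeffs := by
      ext n
      exact taylorCoeff_add f.mem.1 g.mem.1 n
    have := inner_add_left (𝕜 := ℂ) f.coeffs g.coeffs h.coeffs
    rw [← hadd] at this
    exact this
  smul_left f g c := by
    have hsmul : (c • f).coeffs = c • f.coeffs := by
      ext n
      exact taylorCoeff_smul c f.mem.1 n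
    have := inner_smul_left (𝕜 := ℂ) f.coeffs g.coeffs c
    rw [← hsmul] at this
    exact this
  definite f hf := by
    have h0 : f.coeffs = 0 := inner_self_eq_zero (𝕜 := ℂ) |>.1 hf
    refine HardySpace.ext fun z => ?_
    have hz := hasSum_taylorCoeff f.mem.1 z.norm_lt_one
    have hc : ∀ n, taylorCoeff f n = 0 := fun n => congrArg (fun a : lp (fun _ : ℕ => ℂ) 2 => a n) h0
    simp only [hc, zero_mul, discExtend_coe] at hz
    exact hz.unique hasSum_zero

instance : NormedAddCommGroup HardySpace := HardySpace.innerCore.toNormedAddCommGroup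

instance : InnerProductSpace ℂ HardySpace := InnerProductSpace.ofCore HardySpace.innerCore.toCore

theorem HardySpace.inner_def (f g : HardySpace) :
    ⟪g, f⟫_ℂ = ∑' n, taylorCoeff f n * conj (taylorCoeff g n) := rfl

/-- The norm of `H²` is the limit of the integral means. -/
theorem HardySpace.tendsto_integralMean (f : HardySpace) :
    Filter.Tendsto (fun r => integralMean f r ^ (1 / 2 : ℝ)) (𝓝[<] 1) (𝓝 ‖f‖) := by
  have hsq : ‖f‖ ^ 2 = ∑' n, ‖taylorCoeff f n‖ ^ 2 := by
    rw [← Complex.ofReal_inj, Complex.ofReal_pow, Complex.ofReal_tsum]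
    have h := inner_self_eq_norm_sq_to_K (𝕜 := ℂ) f
    rw [HardySpace.inner_def] at h
    refine h.symm.trans (tsum_congr fun n => ?_)
    rw [Complex.mul_conj, Complex.normSq_eq_norm_sq]
  have hs := summable_sq_taylorCoeff f.mem
  have hlim : Filter.Tendsto (fun r : ℝ => integralMean f r) (𝓝[<] 1) (𝓝 (‖f‖ ^ 2)) := by
    have h1 : Filter.Tendsto (fun r : ℝ => ∑' n, ‖taylorCoeff f n‖ ^ 2 * r ^ (2 * n)) (𝓝[<] 1)
        (𝓝 (∑' n, ‖taylorCoeff f n‖ ^ 2)) := by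
      refine tendsto_tsum_of_dominated_convergence hs (fun n => ?_) ?_
      · have : Filter.Tendsto (fun r : ℝ => ‖taylorCoeff f n‖ ^ 2 * r ^ (2 * n)) (𝓝[<] 1)
            (𝓝 (‖taylorCoeff f n‖ ^ 2 * 1 ^ (2 * n))) :=
          Filter.Tendsto.mono_left (Continuous.tendsto (by fun_prop) 1) nhdsWithin_le_nhds
        simpa using this
      · filter_upwards [Ioo_mem_nhdsLT (zero_lt_one (α := ℝ))] with r hr n
        rw [norm_mul, norm_pow, norm_norm, norm_pow, Real.norm_of_nonneg hr.1.le]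
        exact mul_le_of_le_one_right (by positivity) (pow_le_one₀ hr.1.le hr.2.le)
    rw [hsq]
    refine h1.congr' ?_
    filter_upwards [Ioo_mem_nhdsLT (zero_lt_one (α := ℝ))] with r hr
    exact (hasSum_integralMean f.mem.1 hr).tsum_eq
  have := hlim.rpow_const (p := (1 / 2 : ℝ)) (Or.inr (by norm_num))
  rwa [← Real.sqrt_eq_rpow, Real.sqrt_sq (norm_nonneg f)] at this

/-- The Blaschke factor with zero `a`: `b₀(z) = z`, and otherwise
`(|a| / a) (a - z) / (1 - conj a z)`. -/
def blaschkeFactor (a z : UnitDisc) : ℂ :=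
  if (a : ℂ) = 0 then z else (‖(a : ℂ)‖ / a) * ((a - z) / (1 - conj (a : ℂ) * z))

/-- `u` is a Blaschke product with zeros `lam i`, repeated according to multiplicity: the zeros satisfy
the Blaschke condition and `u` is a unimodular constant times the product of their Blaschke
factors. -/
def IsBlaschkeProduct {ι : Type*} (u : UnitDisc → ℂ) (lam : ι → UnitDisc) : Prop :=
  Summable (fun i => 1 - ‖(lam i : ℂ)‖) ∧
    ∃ c : ℂ, ‖c‖ = 1 ∧ ∀ z, u z = c * ∏' i, blaschkeFactor (lam i) z

/-- `uH²`, the members of `H²` of the form `u h` with `h ∈ H²`. -/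
def mulHardy (u : UnitDisc → ℂ) : Submodule ℂ HardySpace where
  carrier := {f | ∃ h : HardySpace, ∀ z, f z = u z * h z}
  zero_mem' := ⟨0, fun z => by simp [HardySpace.toFun_zero]⟩
  add_mem' := by
    rintro f g ⟨h, hh⟩ ⟨k, hk⟩
    exact ⟨h + k, fun z => by simp [HardySpace.toFun_add, hh, hk, mul_add]⟩
  smul_mem' := by
    rintro c f ⟨h, hh⟩
    exact ⟨c • h, fun z => by simp [HardySpace.toFun_smul, hh, mul_left_comm]⟩

/-- The space `𝒦_u`, the orthogonal complement of `uH²` in `H²`. -/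
def modelSpace (u : UnitDisc → ℂ) : Submodule ℂ HardySpace := (mulHardy u)ᗮ

/-- The function `k_a(z) = (1 - conj (u a) u z) / (1 - conj a z)`, the reproducing kernel of `𝒦_u` at
`a` when `u` is inner. -/
def modelKernel (u : UnitDisc → ℂ) (a z : UnitDisc) : ℂ :=
  (1 - conj (u a) * u z) / (1 - conj (a : ℂ) * z)

theorem norm_conj_mul_lt_one (a : UnitDisc) {z : ℂ} (hz : ‖z‖ < 1) : ‖conj (a : ℂ) * z‖ < 1 := by
  rw [norm_mul, Complex.norm_conj]
  exact mul_lt_one_of_nonneg_of_lt_one_left (norm_nonneg _) a.norm_lt_one hz.le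

theorem cauchyKernel_mem (a : UnitDisc) :
    (fun z : UnitDisc => 1 / (1 - conj (a : ℂ) * z)) ∈ hardySubmodule := by
  have hpos : 0 < 1 - ‖(a : ℂ)‖ := sub_pos.2 a.norm_lt_one
  have hlow : ∀ z : ℂ, ‖z‖ < 1 → 1 - ‖(a : ℂ)‖ ≤ ‖1 - conj (a : ℂ) * z‖ := by
    intro z hz
    have h1 := norm_sub_norm_le (1 : ℂ) (conj (a : ℂ) * z)
    rw [norm_one, norm_mul, Complex.norm_conj] at h1
    nlinarith [norm_nonneg (a : ℂ)]
  have han : IsDiscAnalytic (fun z : UnitDisc => 1 / (1 - conj (a : ℂ) * z)) := by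
    have hd : DifferentiableOn ℂ (fun z : ℂ => 1 / (1 - conj (a : ℂ) * z)) (Metric.ball 0 1) := by
      refine DifferentiableOn.div (by fun_prop) (by fun_prop) fun z hz h0 => ?_
      have := hlow z (by simpa using hz)
      rw [h0, norm_zero] at this
      linarith
    refine hd.congr fun z hz => ?_
    rw [discExtend_of_lt _ (by simpa using hz)]
    rfl
  refine ⟨han, ((1 - ‖(a : ℂ)‖)⁻¹) ^ 2, fun r hr => ?_⟩
  refine Real.circleAverage_mono_on_of_le_circle (han.circleIntegrable_sq hr) fun z hz => ?_
  have hz1 : ‖z‖ < 1 := by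
    have : ‖z‖ = r := by simpa [abs_of_pos hr.1] using hz
    rw [this]; exact hr.2
  refine pow_le_pow_left₀ (norm_nonneg _) ?_ 2
  rw [discExtend_of_lt _ hz1, UnitDisc.coe_mk, one_div, norm_inv]
  exact inv_anti₀ hpos (hlow z hz1)

/-- The Cauchy kernel `z ↦ 1 / (1 - conj a z)` as a member of `H²`. -/
def cauchyKernel (a : UnitDisc) : HardySpace :=
  ⟨fun z : UnitDisc => 1 / (1 - conj (a : ℂ) * z), cauchyKernel_mem a⟩

/-- `f` extends continuously to the closed unit disk, and the values of the extension on the unit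
circle form an infinitely differentiable function. -/
def IsContinuousWithSmoothBoundary (f : UnitDisc → ℂ) : Prop :=
  ∃ F : ℂ → ℂ, ContinuousOn F (Metric.closedBall 0 1) ∧ (∀ z : UnitDisc, F z = f z) ∧
    ContMDiff (𝓡 1) 𝓘(ℝ, ℂ) ∞ fun ζ : Circle => F ζ

end

end ModelSpace

open scoped ComplexConjugate ContDiff Manifold InnerProductSpace Topology

namespace ModelSpace

open Complex

noncomputable section

/-! Since `u` vanishes at each zero, the model kernel there is the Cauchy kernel, and pairing with
it evaluates a function at that zero (`inner_cauchyKernel`). So the orthogonal complement of the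
span of the kernels consists of the members of `H²` vanishing at all zeros. The heart of the proof
is that these are exactly `uH²` (`mem_mulHardy_iff`). As `H²` is complete, a second orthogonal
complement turns the span into its closure and `uH²` into `𝒦_u`. The span itself is the dense set,
because a Cauchy kernel is smooth up to the circle.

Divisibility by `u` is obtained without boundary values. Near the circle a Blaschke factor has
modulus close to one, so dividing out a zero does not increase the norm
(`HardySpace.exists_blaschkeFactor_mul`). The quotients by finite subproducts therefore stay in a
fixed ball. Weak compactness gives them a limit in `H²`, pointwise because evaluations are inner
products, while the subproducts converge to the full product. -/

/-! ### Power series and completeness of `H²`. -/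

theorem hasFPowerSeriesOnBall_of_hasSum {g : ℂ → ℂ} {a : ℕ → ℂ}
    (h : ∀ z : ℂ, ‖z‖ < 1 → HasSum (fun n => a n * z ^ n) (g z)) :
    HasFPowerSeriesOnBall g (FormalMultilinearSeries.ofScalars ℂ a) 0 1 where
  r_le := by
    refine ENNReal.le_of_forall_nnreal_lt fun r hr => ?_
    refine FormalMultilinearSeries.le_radius_of_summable_norm _ ?_
    -- The radius `r` is itself a point of the disk, and convergence in `ℂ` is absolute.
    have hr1 : ‖((r : ℝ) : ℂ)‖ < 1 := by
      rw [Complex.norm_real, Real.norm_of_nonneg r.coe_nonneg]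
      exact_mod_cast hr
    refine (h _ hr1).summable.norm.congr fun n => ?_
    rw [FormalMultilinearSeries.ofScalars_norm, norm_mul, norm_pow, Complex.norm_real,
      Real.norm_of_nonneg r.coe_nonneg]
  r_pos := one_pos
  hasSum := by
    intro y hy
    have hy1 : ‖y‖ < 1 := by
      rwa [← ENNReal.ofReal_one, Metric.eball_ofReal, mem_ball_zero_iff] at hy
    simpa only [FormalMultilinearSeries.ofScalars_apply_eq, smul_eq_mul, zero_add] using h y hy1

theorem isDiscAnalytic_of_hasSum {f : UnitDisc → ℂ} {a : ℕ → ℂ}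
    (h : ∀ z : ℂ, ‖z‖ < 1 → HasSum (fun n => a n * z ^ n) (discExtend f z)) :
    IsDiscAnalytic f := by
  have := (hasFPowerSeriesOnBall_of_hasSum h).differentiableOn
  rwa [← ENNReal.ofReal_one, Metric.eball_ofReal] at this

theorem taylorCoeff_eq_of_hasSum {f : UnitDisc → ℂ} {a : ℕ → ℂ}
    (h : ∀ z : ℂ, ‖z‖ < 1 → HasSum (fun n => a n * z ^ n) (discExtend f z)) :
    taylorCoeff f = a := by
  have h1 := (hasFPowerSeriesOnBall_of_hasSum h).hasFPowerSeriesAt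
  have h2 := (hasFPowerSeriesOnBall_of_hasSum fun z hz =>
    hasSum_taylorCoeff (isDiscAnalytic_of_hasSum h) hz).hasFPowerSeriesAt
  exact FormalMultilinearSeries.ofScalars_series_injective ℂ ℂ (h2.eq_formalMultilinearSeries h1)

/-- The Taylor coefficients of a member of `H²` as a linear isometry into `ℓ²`. -/
def HardySpace.coeffsLI : HardySpace →ₗᵢ[ℂ] lp (fun _ : ℕ => ℂ) 2 where
  toFun := HardySpace.coeffs
  map_add' f g := by
    ext n
    exact taylorCoeff_add f.mem.1 g.mem.1 n
  map_smul' c f := by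
    ext n
    exact taylorCoeff_smul c f.mem.1 n
  norm_map' f := by
    have h : ⟪f.coeffs, f.coeffs⟫_ℂ = ⟪f, f⟫_ℂ := rfl
    rw [inner_self_eq_norm_sq_to_K, inner_self_eq_norm_sq_to_K] at h
    have h' : ‖f.coeffs‖ ^ 2 = ‖f‖ ^ 2 := by exact_mod_cast h
    exact (pow_left_inj₀ (norm_nonneg _) (norm_nonneg _) two_ne_zero).1 h'

/-- A square-summable sequence is bounded, so its power series converges on the disk; Parseval then
bounds the integral means by the `ℓ²` sum. This carries completeness over from `ℓ²`, as needed for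
Riesz representation and for double orthogonal complements. -/
theorem HardySpace.coeffs_surjective :
    Function.Surjective (HardySpace.coeffs : HardySpace → lp (fun _ : ℕ => ℂ) 2) := by
  intro a
  have hsq : Summable fun n => ‖a n‖ ^ 2 := by
    simpa using (lp.memℓp a).summable (by norm_num)
  have hsum : ∀ z : ℂ, ‖z‖ < 1 → Summable fun n => a n * z ^ n := by
    intro z hz
    refine Summable.of_norm_bounded
      ((summable_geometric_of_lt_one (norm_nonneg z) hz).mul_left ‖a‖) fun n => ?_
    rw [norm_mul, norm_pow]
    exact mul_le_mul_of_nonneg_right (lp.norm_apply_le_norm two_ne_zero a n) (by positivity)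
  let f : UnitDisc → ℂ := fun z => ∑' n, a n * (z : ℂ) ^ n
  have hf : ∀ z : ℂ, ‖z‖ < 1 → HasSum (fun n => a n * z ^ n) (discExtend f z) := by
    intro z hz
    rw [discExtend_of_lt _ hz]
    exact (hsum z hz).hasSum
  have hfa := isDiscAnalytic_of_hasSum hf
  have hfc := taylorCoeff_eq_of_hasSum hf
  refine ⟨⟨f, hfa, ∑' n, ‖a n‖ ^ 2, fun r hr => ?_⟩, ?_⟩
  · have h := hasSum_integralMean hfa hr
    rw [hfc] at h
    refine hasSum_le (fun n => ?_) h hsq.hasSum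
    exact mul_le_of_le_one_right (by positivity) (pow_le_one₀ hr.1.le hr.2.le)
  · ext n
    exact congrFun hfc n

instance : CompleteSpace HardySpace :=
  (LinearIsometryEquiv.ofSurjective HardySpace.coeffsLI
    HardySpace.coeffs_surjective).toIsometryEquiv.completeSpace

/-! ### The reproducing property of the Cauchy kernel. -/

theorem taylorCoeff_cauchyKernel (a : UnitDisc) (n : ℕ) :
    taylorCoeff (cauchyKernel a) n = conj (a : ℂ) ^ n := by
  refine congrFun (taylorCoeff_eq_of_hasSum (a := fun n => conj (a : ℂ) ^ n) fun z hz => ?_) n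
  rw [discExtend_of_lt _ hz]
  simp only [← mul_pow]
  have h := hasSum_geometric_of_norm_lt_one (norm_conj_mul_lt_one a hz)
  rw [← one_div] at h
  exact h

/-- The Cauchy kernel is the reproducing kernel of `H²`. -/
theorem inner_cauchyKernel (a : UnitDisc) (f : HardySpace) : ⟪cauchyKernel a, f⟫_ℂ = f a := by
  rw [HardySpace.inner_def]
  have h := hasSum_taylorCoeff f.mem.1 a.norm_lt_one
  rw [discExtend_coe] at h
  rw [← h.tsum_eq]
  refine tsum_congr fun n => ?_
  rw [taylorCoeff_cauchyKernel, map_pow, Complex.conj_conj]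

/-! ### Integral means near the circle. -/

theorem integralMean_nonneg {f : UnitDisc → ℂ} (hf : IsDiscAnalytic f) {r : ℝ}
    (hr : r ∈ Set.Ioo (0 : ℝ) 1) : 0 ≤ integralMean f r :=
  (hasSum_integralMean hf hr).nonneg fun _ =>
    mul_nonneg (by positivity) (pow_nonneg hr.1.le _)

theorem integralMean_mono {f : UnitDisc → ℂ} (hf : IsDiscAnalytic f) {r s : ℝ}
    (hr : r ∈ Set.Ioo (0 : ℝ) 1) (hs : s ∈ Set.Ioo (0 : ℝ) 1) (hrs : r ≤ s) :
    integralMean f r ≤ integralMean f s :=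
  hasSum_le (fun _ => mul_le_mul_of_nonneg_left (pow_le_pow_left₀ hr.1.le hrs _) (by positivity))
    (hasSum_integralMean hf hr) (hasSum_integralMean hf hs)

/-- By Parseval the means increase with the radius, so only radii near one matter. The estimate for
quotients by a Blaschke factor is useful only there. -/
theorem mem_hardySubmodule_of_eventually_le {f : UnitDisc → ℂ} (hf : IsDiscAnalytic f) {C : ℝ}
    (hC : ∀ᶠ r in 𝓝[<] (1 : ℝ), integralMean f r ≤ C) : f ∈ hardySubmodule := by
  refine ⟨hf, C, fun r hr => ?_⟩
  obtain ⟨s, hsC, hs⟩ := (hC.and (Ioo_mem_nhdsLT hr.2)).exists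
  exact (integralMean_mono hf hr ⟨hr.1.trans hs.1, hs.2⟩ hs.1.le).trans hsC

theorem HardySpace.tendsto_integralMean_sq (f : HardySpace) :
    Filter.Tendsto (fun r => integralMean f r) (𝓝[<] 1) (𝓝 (‖f‖ ^ 2)) := by
  refine (f.tendsto_integralMean.pow 2).congr' ?_
  filter_upwards [Ioo_mem_nhdsLT (zero_lt_one (α := ℝ))] with r hr
  rw [← Real.sqrt_eq_rpow, Real.sq_sqrt (integralMean_nonneg f.mem.1 hr)]

/-! ### Division by finite Blaschke products. -/

theorem one_sub_norm_le_norm_one_sub_conj_mul (a : UnitDisc) {z : ℂ} (hz : ‖z‖ ≤ 1) :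
    1 - ‖(a : ℂ)‖ ≤ ‖1 - conj (a : ℂ) * z‖ := by
  have h := norm_sub_norm_le (1 : ℂ) (conj (a : ℂ) * z)
  rw [norm_one, norm_mul, Complex.norm_conj] at h
  nlinarith [norm_nonneg (a : ℂ)]

theorem one_sub_conj_mul_ne_zero (a : UnitDisc) {z : ℂ} (hz : ‖z‖ ≤ 1) :
    1 - conj (a : ℂ) * z ≠ 0 := by
  rw [← norm_pos_iff]
  exact (sub_pos.2 a.norm_lt_one).trans_le (one_sub_norm_le_norm_one_sub_conj_mul a hz)

theorem exists_blaschkeFactor_eq (a : UnitDisc) : ∃ κ : ℂ, κ ≠ 0 ∧ ‖κ‖ = 1 ∧ ∀ z : UnitDisc,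
    blaschkeFactor a z = κ * ((z - a) / (1 - conj (a : ℂ) * z)) := by
  by_cases ha : (a : ℂ) = 0
  · exact ⟨1, one_ne_zero, norm_one, fun z => by simp [blaschkeFactor, ha]⟩
  · have ha' : ‖(a : ℂ)‖ ≠ 0 := norm_ne_zero_iff.2 ha
    refine ⟨-(‖(a : ℂ)‖ / a), by simp [ha], by simp [ha], fun z => ?_⟩
    rw [blaschkeFactor, if_neg ha]
    ring

/-- After division by `‖1 - conj a * z‖ ^ 2`, this measures how far the squared modulus of a
Blaschke factor is from one. -/
theorem norm_one_sub_conj_mul_sq (a z : ℂ) :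
    ‖1 - conj a * z‖ ^ 2 - ‖z - a‖ ^ 2 = (1 - ‖a‖ ^ 2) * (1 - ‖z‖ ^ 2) := by
  simp only [← Complex.normSq_eq_norm_sq, Complex.normSq_apply, Complex.sub_re, Complex.sub_im,
    Complex.mul_re, Complex.mul_im, Complex.conj_re, Complex.conj_im, Complex.one_re,
    Complex.one_im]
  ring

/-- The Blaschke factor with zero `a` is close to having modulus one near the circle. -/
theorem norm_one_sub_conj_mul_sq_le (a : UnitDisc) {z : ℂ} (hz : ‖z‖ < 1) :
    (1 - 2 / (1 - ‖(a : ℂ)‖) * (1 - ‖z‖ ^ 2)) * ‖1 - conj (a : ℂ) * z‖ ^ 2 ≤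
      ‖z - a‖ ^ 2 := by
  have hpos : 0 < 1 - ‖(a : ℂ)‖ := sub_pos.2 a.norm_lt_one
  have hlow := one_sub_norm_le_norm_one_sub_conj_mul a hz.le
  have hid := norm_one_sub_conj_mul_sq a z
  have hz2 : 0 ≤ 1 - ‖z‖ ^ 2 := by nlinarith [norm_nonneg z]
  -- The constant comes from `1 - ‖a‖ ^ 2 ≤ 2 * (1 - ‖a‖)` and `(1 - ‖a‖) ^ 2 ≤ ‖1 - conj a * z‖ ^
  -- 2`.
  have hD : 1 - ‖(a : ℂ)‖ ^ 2 ≤ 2 / (1 - ‖(a : ℂ)‖) * ‖1 - conj (a : ℂ) * z‖ ^ 2 := by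
    rw [div_mul_eq_mul_div, le_div_iff₀ hpos]
    have h1 := pow_le_pow_left₀ hpos.le hlow 2
    nlinarith [norm_nonneg (a : ℂ), mul_nonneg hpos.le hpos.le,
      mul_nonneg (mul_nonneg hpos.le hpos.le) hpos.le]
  have := mul_le_mul_of_nonneg_right hD hz2
  linarith

/-- Division by a Blaschke factor does not increase the norm of `H²`. -/
theorem HardySpace.exists_blaschkeFactor_mul (f : HardySpace) (a : UnitDisc) (hfa : f a = 0) :
    ∃ h : HardySpace, (∀ z, f z = blaschkeFactor a z * h z) ∧ ‖h‖ ≤ ‖f‖ := by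
  obtain ⟨κ, hκ, hκ1, hb⟩ := exists_blaschkeFactor_eq a
  have hnhds : Metric.ball (0 : ℂ) 1 ∈ 𝓝 (a : ℂ) :=
    Metric.isOpen_ball.mem_nhds (by simpa using a.norm_lt_one)
  let g : ℂ → ℂ := dslope (discExtend f) a
  have hg : DifferentiableOn ℂ g (Metric.ball 0 1) :=
    (Complex.differentiableOn_dslope hnhds).2 f.mem.1
  have hfg : ∀ z, discExtend f z = (z - a) * g z := by
    intro z
    have := sub_smul_dslope (discExtend f) (a : ℂ) z
    rw [discExtend_coe, hfa, sub_zero, smul_eq_mul] at this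
    exact this.symm
  -- This is the quotient of `f` by the Blaschke factor, with the singularity at `a` removed by
  -- `dslope`.
  let h : UnitDisc → ℂ := fun z => κ⁻¹ * ((1 - conj (a : ℂ) * z) * g z)
  have hext : ∀ z : ℂ, ‖z‖ < 1 → discExtend h z = κ⁻¹ * ((1 - conj (a : ℂ) * z) * g z) :=
    fun z hz => discExtend_of_lt h hz
  have hh : IsDiscAnalytic h := by
    have hd : DifferentiableOn ℂ (fun z : ℂ => κ⁻¹ * ((1 - conj (a : ℂ) * z) * g z))
        (Metric.ball 0 1) :=
      DifferentiableOn.const_mul (DifferentiableOn.mul (by fun_prop) hg) _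
    exact hd.congr fun z hz => hext z (by simpa using hz)
  -- A lower bound for the squared modulus of the Blaschke factor on the circle of radius `r`.
  let w : ℝ → ℝ := fun r => 1 - 2 / (1 - ‖(a : ℂ)‖) * (1 - r ^ 2)
  have hw : Filter.Tendsto w (𝓝[<] 1) (𝓝 1) := by
    have : Filter.Tendsto w (𝓝[<] 1) (𝓝 (w 1)) :=
      Filter.Tendsto.mono_left (Continuous.tendsto (by fun_prop) 1) nhdsWithin_le_nhds
    simpa [w] using this
  have hmean : ∀ r ∈ Set.Ioo (0 : ℝ) 1, w r * integralMean h r ≤ integralMean f r := by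
    intro r hr
    rw [integralMean, ← smul_eq_mul, ← Real.circleAverage_smul]
    refine Real.circleAverage_mono ((hh.circleIntegrable_sq hr).const_smul (a := w r))
      (f.mem.1.circleIntegrable_sq hr) fun z hz => ?_
    have hzr : ‖z‖ = r := by simpa [abs_of_pos hr.1] using hz
    have hz1 : ‖z‖ < 1 := hzr ▸ hr.2
    have := mul_le_mul_of_nonneg_right (norm_one_sub_conj_mul_sq_le a hz1) (sq_nonneg ‖g z‖)
    rw [hzr] at this
    simp only [Pi.smul_apply, smul_eq_mul, hext z hz1, hfg, norm_mul, norm_inv, hκ1, inv_one,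
      one_mul, mul_pow]
    linarith
  have hmem : h ∈ hardySubmodule := by
    obtain ⟨-, C, hC⟩ := f.mem
    -- The factor 2 reflects `w r > 1 / 2` near the circle.
    refine mem_hardySubmodule_of_eventually_le hh (C := 2 * C) ?_
    filter_upwards [hw.eventually (lt_mem_nhds (show (1 / 2 : ℝ) < 1 by norm_num)),
      Ioo_mem_nhdsLT (zero_lt_one (α := ℝ))] with r hwr hr
    nlinarith [hmean r hr, hC r hr, integralMean_nonneg hh hr]
  refine ⟨⟨h, hmem⟩, fun z => ?_, ?_⟩
  · have h1 := one_sub_conj_mul_ne_zero a z.norm_lt_one.le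
    rw [mul_comm (conj _)] at h1
    have h2 := hfg z
    rw [discExtend_coe] at h2
    change f z = _ * (κ⁻¹ * ((1 - conj (a : ℂ) * z) * g z))
    rw [hb, h2, mul_comm (conj _)]
    field_simp
  · refine (pow_le_pow_iff_left₀ (norm_nonneg _) (norm_nonneg _) two_ne_zero).1 ?_
    -- Since `w` tends to one, the norm bound has constant exactly one and survives any number of
    -- divisions.
    have hlim := hw.mul (HardySpace.tendsto_integralMean_sq ⟨h, hmem⟩)
    rw [one_mul] at hlim
    refine le_of_tendsto_of_tendsto hlim f.tendsto_integralMean_sq ?_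
    filter_upwards [Ioo_mem_nhdsLT (zero_lt_one (α := ℝ))] with r hr
    exact hmean r hr

theorem blaschkeFactor_self (a : UnitDisc) : blaschkeFactor a a = 0 := by
  obtain ⟨κ, -, -, hb⟩ := exists_blaschkeFactor_eq a
  simp [hb]

theorem blaschkeFactor_ne_zero {a z : UnitDisc} (h : z ≠ a) : blaschkeFactor a z ≠ 0 := by
  obtain ⟨κ, hκ, -, hb⟩ := exists_blaschkeFactor_eq a
  rw [hb]
  refine mul_ne_zero hκ (div_ne_zero (sub_ne_zero.2 fun h0 => h ?_)
    (one_sub_conj_mul_ne_zero a z.norm_lt_one.le))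
  exact UnitDisc.coe_injective h0

/-- Division by a finite Blaschke product does not increase the norm of `H²`. -/
theorem HardySpace.exists_prod_blaschkeFactor_mul {ι : Type*} {lam : ι → UnitDisc}
    (hlam : Function.Injective lam) (f : HardySpace) (hf : ∀ i, f (lam i) = 0) (s : Finset ι) :
    ∃ h : HardySpace, (∀ z, f z = (∏ i ∈ s, blaschkeFactor (lam i) z) * h z) ∧ ‖h‖ ≤ ‖f‖ := by
  classical
  induction s using Finset.induction_on with
  | empty => exact ⟨f, fun z => by simp, le_rfl⟩
  | insert j s hj ih =>
    obtain ⟨h, hh, hle⟩ := ih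
    -- The zeros are distinct, so the factors already removed do not vanish at `lam j` and the
    -- quotient inherits this zero.
    have h0 : h (lam j) = 0 := by
      have := hh (lam j)
      rw [hf j, zero_eq_mul, Finset.prod_eq_zero_iff] at this
      refine this.resolve_left ?_
      rintro ⟨i, hi, hb⟩
      refine blaschkeFactor_ne_zero (fun heq => ?_) hb
      exact hj (hlam heq ▸ hi)
    obtain ⟨k, hk, hkle⟩ := h.exists_blaschkeFactor_mul (lam j) h0
    refine ⟨k, fun z => ?_, hkle.trans hle⟩
    rw [hh z, hk z, Finset.prod_insert hj]
    ring

/-! ### Infinite Blaschke products and division by them. -/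

/-- The normalization `‖a‖ / a` makes `1 - ‖a‖` split off from the difference, so the Blaschke
condition gives convergence of the product at each point. -/
theorem norm_one_sub_blaschkeFactor_le (a z : UnitDisc) :
    ‖blaschkeFactor a z - 1‖ ≤ 2 / (1 - ‖(z : ℂ)‖) * (1 - ‖(a : ℂ)‖) := by
  have hz : 0 < 1 - ‖(z : ℂ)‖ := sub_pos.2 z.norm_lt_one
  have ha1 : 0 < 1 - ‖(a : ℂ)‖ := sub_pos.2 a.norm_lt_one
  by_cases ha : (a : ℂ) = 0
  · rw [blaschkeFactor, if_pos ha, ha, norm_zero, sub_zero, mul_one]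
    calc ‖(z : ℂ) - 1‖ ≤ ‖(z : ℂ)‖ + ‖(1 : ℂ)‖ := norm_sub_le _ _
      _ ≤ 2 / 1 := by rw [norm_one]; linarith
      _ ≤ 2 / (1 - ‖(z : ℂ)‖) :=
        div_le_div_of_nonneg_left two_pos.le hz (by linarith [norm_nonneg (z : ℂ)])
  · have hne := one_sub_conj_mul_ne_zero a z.norm_lt_one.le
    have hne' := hne
    rw [mul_comm (conj _)] at hne'
    have hconj : conj (a : ℂ) * a = (‖(a : ℂ)‖ : ℂ) ^ 2 := Complex.conj_mul' _
    have heq : blaschkeFactor a z - 1 =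
        -((1 - ‖(a : ℂ)‖ : ℝ) * (1 + (‖(a : ℂ)‖ : ℂ) / a * z) / (1 - conj (a : ℂ) * z)) := by
      rw [blaschkeFactor, if_neg ha]
      push_cast
      field_simp
      linear_combination (z : ℂ) * hconj
    have hlow : 1 - ‖(z : ℂ)‖ ≤ ‖1 - conj (a : ℂ) * z‖ := by
      have h := norm_sub_norm_le (1 : ℂ) (conj (a : ℂ) * z)
      rw [norm_one, norm_mul, Complex.norm_conj] at h
      nlinarith [norm_nonneg (z : ℂ)]
    have hnum : ‖1 + (‖(a : ℂ)‖ : ℂ) / a * z‖ ≤ 2 := by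
      refine (norm_add_le _ _).trans ?_
      rw [norm_one, norm_mul, norm_div, Complex.norm_real, norm_norm,
        div_self (norm_ne_zero_iff.2 ha), one_mul]
      linarith
    rw [heq, norm_neg, norm_div, norm_mul, Complex.norm_real, Real.norm_of_nonneg ha1.le,
      mul_comm (2 / _), mul_div_assoc]
    exact mul_le_mul_of_nonneg_left (div_le_div₀ two_pos.le hnum hz hlow) ha1.le

theorem multipliable_blaschkeFactor {ι : Type*} {lam : ι → UnitDisc}
    (h : Summable fun i => 1 - ‖(lam i : ℂ)‖) (z : UnitDisc) :
    Multipliable fun i => blaschkeFactor (lam i) z := by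
  have := multipliable_one_add_of_summable (f := fun i => blaschkeFactor (lam i) z - 1)
    (Summable.of_nonneg_of_le (fun _ => norm_nonneg _)
      (fun i => norm_one_sub_blaschkeFactor_le (lam i) z) (h.mul_left _))
  simpa using this

/-- A bounded family in `H²` has, along every ultrafilter, a pointwise limit in `H²`. -/
theorem HardySpace.exists_tendsto_apply {α : Type*} (𝒰 : Ultrafilter α) (h : α → HardySpace)
    {R : ℝ} (hR : ∀ s, ‖h s‖ ≤ R) :
    ∃ k : HardySpace, ∀ z, Filter.Tendsto (fun s => h s z) 𝒰 (𝓝 (k z)) := by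
  -- Vectors are viewed as functionals in order to apply the Banach–Alaoglu theorem. `D` is
  -- conjugate-linear, whence the conjugation when returning to point values.
  let D : HardySpace → WeakDual ℂ HardySpace := fun x =>
    StrongDual.toWeakDual (InnerProductSpace.toDual ℂ HardySpace x)
  have hD : ∀ x y, D x y = ⟪x, y⟫_ℂ := fun x y => rfl
  obtain ⟨φ, -, hφ⟩ := (WeakDual.isCompact_closedBall (0 : StrongDual ℂ HardySpace)
    R).ultrafilter_le_nhds (𝒰.map (D ∘ h)) (by
      rw [Filter.le_principal_iff]
      refine Filter.mem_map.2 (Filter.Eventually.of_forall fun s => ?_)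
      change InnerProductSpace.toDual ℂ HardySpace (h s) ∈ Metric.closedBall _ _
      rw [mem_closedBall_zero_iff]
      exact ((InnerProductSpace.toDual ℂ HardySpace).norm_map (h s)).trans_le (hR s))
  let k : HardySpace := (InnerProductSpace.toDual ℂ HardySpace).symm (WeakDual.toStrongDual φ)
  refine ⟨k, fun z => ?_⟩
  have hk : φ (cauchyKernel z) = ⟪k, cauchyKernel z⟫_ℂ := by
    rw [InnerProductSpace.toDual_symm_apply]
    rfl
  have h1 : Filter.Tendsto (fun s => D (h s) (cauchyKernel z)) 𝒰 (𝓝 (φ (cauchyKernel z))) :=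
    ((WeakDual.eval_continuous (cauchyKernel z)).tendsto φ).comp hφ
  rw [hk] at h1
  have h2 := (Complex.continuous_conj.tendsto _).comp h1
  rw [inner_conj_symm, inner_cauchyKernel] at h2
  refine h2.congr fun s => ?_
  rw [Function.comp_apply, hD, inner_conj_symm, inner_cauchyKernel]

theorem IsBlaschkeProduct.apply_zero {ι : Type*} {u : UnitDisc → ℂ} {lam : ι → UnitDisc}
    (hu : IsBlaschkeProduct u lam) (i : ι) : u (lam i) = 0 := by
  obtain ⟨-, c, -, hc⟩ := hu
  -- All finite subproducts containing the index `i` vanish.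
  rw [hc, tprod_of_exists_eq_zero ⟨i, blaschkeFactor_self _⟩, mul_zero]

/-- A member of `H²` vanishing at the zeros of a Blaschke product with simple zeros is divisible by
this product. -/
theorem mem_mulHardy_iff {ι : Type*} {u : UnitDisc → ℂ} {lam : ι → UnitDisc}
    (hlam : Function.Injective lam) (hu : IsBlaschkeProduct u lam) (f : HardySpace) :
    f ∈ mulHardy u ↔ ∀ i, f (lam i) = 0 := by
  constructor
  · rintro ⟨h, hh⟩ i
    rw [hh, hu.apply_zero, zero_mul]
  · intro hf
    obtain ⟨hs, c, hc1, hc⟩ := hu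
    have hc0 : c ≠ 0 := norm_ne_zero_iff.1 (hc1 ▸ one_ne_zero)
    choose h hh hle using f.exists_prod_blaschkeFactor_mul hlam hf
    -- An ultrafilter finer than `atTop` provides the weak limit of the quotients and keeps the
    -- convergence of the finite subproducts.
    let 𝒰 : Ultrafilter (Finset ι) := Ultrafilter.of Filter.atTop
    obtain ⟨k, hk⟩ := HardySpace.exists_tendsto_apply 𝒰 h hle
    refine ⟨c⁻¹ • k, fun z => ?_⟩
    have hprod : Filter.Tendsto (fun s => ∏ i ∈ s, blaschkeFactor (lam i) z) 𝒰
        (𝓝 (∏' i, blaschkeFactor (lam i) z)) :=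
      Filter.Tendsto.mono_left (multipliable_blaschkeFactor hs z).hasProd
        (Ultrafilter.of_le Filter.atTop)
    have hlim := hprod.mul (hk z)
    simp only [← hh] at hlim
    have heq := tendsto_nhds_unique hlim tendsto_const_nhds
    rw [← heq, hc, HardySpace.toFun_smul, Pi.smul_apply, smul_eq_mul]
    field_simp

/-! ### The span of the kernels and smoothness at the boundary. -/

theorem orthogonal_span_cauchyKernel {ι : Type*} {u : UnitDisc → ℂ} {lam : ι → UnitDisc}
    (hlam : Function.Injective lam) (hu : IsBlaschkeProduct u lam) :
    (Submodule.span ℂ (Set.range fun i => cauchyKernel (lam i)))ᗮ = mulHardy u := by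
  ext f
  rw [mem_mulHardy_iff hlam hu, Submodule.mem_orthogonal]
  constructor
  · intro h i
    rw [← inner_cauchyKernel]
    exact h _ (Submodule.subset_span ⟨i, rfl⟩)
  · intro h x hx
    induction hx using Submodule.span_induction with
    | mem x hx =>
      obtain ⟨i, rfl⟩ := hx
      rw [inner_cauchyKernel, h i]
    | zero => exact inner_zero_left _
    | add x y _ _ hx hy => rw [inner_add_left, hx, hy, add_zero]
    | smul c x _ hx => rw [inner_smul_left, hx, mul_zero]

/-- The only pole lies outside the closed disk, so the same formula serves as the extension;
restriction to the circle is composition with a smooth inclusion. -/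
theorem isContinuousWithSmoothBoundary_cauchyKernel (a : UnitDisc) :
    IsContinuousWithSmoothBoundary (cauchyKernel a) := by
  have hsmooth : ∀ z : ℂ, ‖z‖ ≤ 1 → ContDiffAt ℝ ∞ (fun z : ℂ => 1 / (1 - conj (a : ℂ) * z)) z := by
    intro z hz
    have hden : ContDiffAt ℝ ∞ (fun z : ℂ => 1 - conj (a : ℂ) * z) z := by fun_prop
    simpa only [one_div] using hden.fun_inv (one_sub_conj_mul_ne_zero a hz)
  refine ⟨fun z => 1 / (1 - conj (a : ℂ) * z), fun z hz => ?_, fun z => rfl, fun ζ => ?_⟩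
  · exact (hsmooth z (by simpa using hz)).continuousAt.continuousWithinAt
  · have : Fact (Module.finrank ℝ ℂ = 1 + 1) := finrank_real_complex_fact'
    exact ContMDiffAt.comp (g := fun z : ℂ => 1 / (1 - conj (a : ℂ) * z)) ζ
      (hsmooth ζ ζ.norm_coe.le).contMDiffAt (contMDiff_coe_sphere (E := ℂ) (n := 1) ζ)

theorem IsContinuousWithSmoothBoundary.add {f g : UnitDisc → ℂ}
    (hf : IsContinuousWithSmoothBoundary f) (hg : IsContinuousWithSmoothBoundary g) :
    IsContinuousWithSmoothBoundary (f + g) := by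
  obtain ⟨F, hF, hFf, hFs⟩ := hf
  obtain ⟨G, hG, hGg, hGs⟩ := hg
  exact ⟨F + G, hF.add hG, fun z => by simp [hFf, hGg], hFs.add hGs⟩

theorem IsContinuousWithSmoothBoundary.smul {f : UnitDisc → ℂ} (c : ℂ)
    (hf : IsContinuousWithSmoothBoundary f) : IsContinuousWithSmoothBoundary (c • f) := by
  obtain ⟨F, hF, hFf, hFs⟩ := hf
  refine ⟨c • F, hF.const_smul c, fun z => by simp [hFf], ?_⟩
  have hc : ContDiff ℝ ∞ fun w : ℂ => c • w := by fun_prop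
  exact hc.contMDiff.comp hFs

theorem isContinuousWithSmoothBoundary_zero : IsContinuousWithSmoothBoundary 0 :=
  ⟨0, continuousOn_const, fun _ => rfl, contMDiff_const⟩

theorem isContinuousWithSmoothBoundary_of_mem_span {ι : Type*} {lam : ι → UnitDisc}
    {f : HardySpace} (hf : f ∈ Submodule.span ℂ (Set.range fun i => cauchyKernel (lam i))) :
    IsContinuousWithSmoothBoundary f := by
  induction hf using Submodule.span_induction with
  | mem x hx =>
    obtain ⟨i, rfl⟩ := hx
    exact isContinuousWithSmoothBoundary_cauchyKernel _
  | zero => exact isContinuousWithSmoothBoundary_zero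
  | add x y _ _ hx hy => exact hx.add hy
  | smul c x _ hx => exact hx.smul c

end

end ModelSpace

theorem mainTheorem9 {ι : Type*} [Countable ι] (u : Complex.UnitDisc → ℂ)
    (lam : ι → Complex.UnitDisc) (hlam : Function.Injective lam)
    (hu : ModelSpace.IsBlaschkeProduct u lam) :
    (∀ i z, ModelSpace.modelKernel u (lam i) z = ModelSpace.cauchyKernel (lam i) z) ∧
    (Submodule.span ℂ (Set.range fun i => ModelSpace.cauchyKernel (lam i))).topologicalClosure =
      ModelSpace.modelSpace u ∧
    ∃ S : Set ModelSpace.HardySpace, S ⊆ ModelSpace.modelSpace u ∧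
      (ModelSpace.modelSpace u : Set ModelSpace.HardySpace) ⊆ closure S ∧
      ∀ f ∈ S, ModelSpace.IsContinuousWithSmoothBoundary f := by
  have hspan : (Submodule.span ℂ
      (Set.range fun i => ModelSpace.cauchyKernel (lam i))).topologicalClosure =
        ModelSpace.modelSpace u := by
    rw [← Submodule.orthogonal_orthogonal_eq_closure,
      ModelSpace.orthogonal_span_cauchyKernel hlam hu, ModelSpace.modelSpace]
  refine ⟨fun i z => ?_, hspan,
    (Submodule.span ℂ (Set.range fun i => ModelSpace.cauchyKernel (lam i)) :
      Set ModelSpace.HardySpace), ?_, ?_,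
    fun f hf => ModelSpace.isContinuousWithSmoothBoundary_of_mem_span hf⟩
  · rw [ModelSpace.modelKernel, hu.apply_zero, map_zero, zero_mul, sub_zero]
    rfl
  · rw [← hspan]
    exact Submodule.le_topologicalClosure _
  · rw [← hspan, Submodule.topologicalClosure_coe]
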